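/- All spaces are Tychonoff. A subset $C$ of a space $X$ is regularly closed if $C=\overline{\operatorname{Int} C}$. A quasi $\kappa$-metric on $X$ is a function $\rho(x,C)\in[0,\infty)$, defined for $x\in X$ and $C\subset X$ regularly closed, such that: (K1)* for every $C$ there is a dense open subset $V$ of $X\setminus C$ such that $\rho(x,C)>0$ if and only if $x\in V$; (K2) if $C\subset C'$, then $\rho(x,C')\le\rho(x,C)$ for every $x\in X$; (K3) for every $C$ the function $x\mapsto\rho(x,C)$ is continuous; (K4) $\rho\bigl(x,\overline{\bigcup_\alpha C_\alpha}\bigr)=\inf_\alpha\rho(x,C_\alpha)$ for every $x\in X$ and every non-empty increasing transfinite (i.e. indexed by a well-ordered set) family $\{C_\alpha\}$ of regularly closed sets. It is regular if moreover (K5) $\rho(x,C)\le\rho(x,C')+\sup\{\rho(y,C):y\in C'\}$ for every $x\in X$ and all regularly closed $C,C'$, where the supremum is taken in $[0,\infty]$ (so that it is $0$ for $C'=\varnothing$). The space $X$ is called (regularly) quasi $\kappa$-metrizable if it admits a (regular) quasi $\kappa$-metric. Let $\exp X$ be the set of all non-empty compact subsets of $X$ with the Vietoris topology, i.e. the topology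 with base the sets $[U_1,\dots,U_k]=\{H\in\exp X: H\subset\bigcup_{i=1}^k U_i\text{ and }H\cap U_i\ne\varnothing\text{ for all }i\}$, where $k\ge 1$ and $U_1,\dots,U_k\subset X$ are open. **Proposition.** Let $X$ be a Tychonoff space. If $X$ is quasi $\kappa$-metrizable, then $\exp X$ is quasi $\kappa$-metrizable. If $X$ is regularly quasi $\kappa$-metrizable, then $\exp X$ is regularly quasi $\kappa$-metrizable. -/

import Mathlib

open Set TopologicalSpace
open scoped NNReal ENNReal

universe u

/-- A set is regularly closed if it is the closure of its interior. -/
def IsRegularlyClosed {X : Type u} [TopologicalSpace X] (C : Set X) : Prop :=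
  closure (interior C) = C

/-- `ρ` is a quasi κ-metric on `X`: a non-negative function `ρ x C` of a point `x` and a regularly
closed set `C` satisfying the four axioms below. The second argument is formally an arbitrary set,
but only the values at regularly closed sets matter. -/
structure IsQuasiKappaMetric {X : Type u} [TopologicalSpace X] (ρ : X → Set X → ℝ≥0) : Prop where
  /-- The positivity set of `ρ · C` is a dense open subset of `X \ C`
  (as `C` is closed, open in `X \ C` and open in `X` are the same). -/
  pos_iff : ∀ C : Set X, IsRegularlyClosed C →
    ∃ V : Set X, IsOpen V ∧ V ⊆ Cᶜ ∧ Cᶜ ⊆ closure V ∧ ∀ x, 0 < ρ x C ↔ x ∈ V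
  /-- Monotonicity. -/
  anti : ∀ C C' : Set X, IsRegularlyClosed C → IsRegularlyClosed C' → C ⊆ C' →
    ∀ x, ρ x C' ≤ ρ x C
  /-- Continuity in the point. -/
  cont : ∀ C : Set X, IsRegularlyClosed C → Continuous fun x => ρ x C
  /-- Increasing transfinite families, that is, families indexed by a non-empty well-ordered set. -/
  closure_iUnion : ∀ (ι : Type u) [LinearOrder ι] [WellFoundedLT ι] [Nonempty ι] (C : ι → Set X),
    (∀ i, IsRegularlyClosed (C i)) → Monotone C →
    ∀ x, ρ x (closure (⋃ i, C i)) = ⨅ i, ρ x (C i)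

/-- A quasi κ-metric is regular if `ρ(x,C) ≤ ρ(x,C') + sup {ρ(y,C) : y ∈ C'}` always holds. The
supremum is taken in `[0,∞]`, so it is `∞` if `ρ · C` is unbounded on `C'`, and `0` if `C' = ∅`. -/
structure IsRegularQuasiKappaMetric {X : Type u} [TopologicalSpace X] (ρ : X → Set X → ℝ≥0) : Prop
    extends IsQuasiKappaMetric ρ where
  le_add_sup : ∀ C C' : Set X, IsRegularlyClosed C → IsRegularlyClosed C' →
    ∀ x, (ρ x C : ℝ≥0∞) ≤ (ρ x C' : ℝ≥0∞) + ⨆ y ∈ C', (ρ y C : ℝ≥0∞)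

/-- A space is quasi κ-metrizable if it admits a quasi κ-metric. -/
def QuasiKappaMetrizable (X : Type u) [TopologicalSpace X] : Prop :=
  ∃ ρ : X → Set X → ℝ≥0, IsQuasiKappaMetric ρ

/-- A space is regularly quasi κ-metrizable if it admits a regular quasi κ-metric. -/
def RegularlyQuasiKappaMetrizable (X : Type u) [TopologicalSpace X] : Prop :=
  ∃ ρ : X → Set X → ℝ≥0, IsRegularQuasiKappaMetric ρ

/-!
Sets of the form `{G | G ∩ D = ∅ and G ⊈ C i for all i}`, where `D ⊆ C i` are regularly closed and
`i` runs over a finite set, are open in `exp X`. The distance from `K` to `𝒞` is the supremum of the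
`s` for which `K` lies `s`-deep in such a box missing `𝒞`: `ρ(x, D) > s` for all `x ∈ K` and
`ρ(x, C i) > s` for some `x ∈ K`, for every `i`. A box with `n` sets `C i` is only admitted for
`n * s < 1`; this bound on `n` makes lower bounds for the distance pass to limits along
ultrafilters, as the lower limits of the sets `D` and `C i` form a box again. The limits yield
both upper semicontinuity and the axiom on transfinite families. For regularity, the compacta lying
`s`-deep in a box form again a box, made of sublevel sets of `ρ`.
-/

open Filter Topology Cardinal

section RegularlyClosed

variable {X : Type u} [TopologicalSpace X]

theorem IsRegularlyClosed.isClosed {C : Set X} (hC : IsRegularlyClosed C) : IsClosed C :=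
  hC ▸ isClosed_closure

theorem IsRegularlyClosed.closure_of_isOpen {U : Set X} (hU : IsOpen U) :
    IsRegularlyClosed (closure U) :=
  (closure_minimal interior_subset isClosed_closure).antisymm
    (closure_mono (interior_maximal subset_closure hU))

theorem IsRegularlyClosed.closure_interior (A : Set X) :
    IsRegularlyClosed (closure (interior A)) :=
  .closure_of_isOpen isOpen_interior

theorem IsRegularlyClosed.closure_iUnion {ι : Sort*} {C : ι → Set X}
    (hC : ∀ i, IsRegularlyClosed (C i)) : IsRegularlyClosed (closure (⋃ i, C i)) := by
  refine (closure_minimal interior_subset isClosed_closure).antisymm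
    (closure_minimal (iUnion_subset fun i => ?_) isClosed_closure)
  exact (hC i).ge.trans (closure_mono (interior_mono ((subset_iUnion C i).trans subset_closure)))

theorem IsRegularlyClosed.biUnion_finset {ι : Type*} {C : ι → Set X}
    (hC : ∀ i, IsRegularlyClosed (C i)) (F : Finset ι) : IsRegularlyClosed (⋃ i ∈ F, C i) := by
  have hcl : IsClosed (⋃ i ∈ F, C i) := F.finite_toSet.isClosed_biUnion fun i _ => (hC i).isClosed
  have hreg := IsRegularlyClosed.closure_iUnion (C := fun i : F => C i) fun i => hC i
  rwa [iUnion_subtype, hcl.closure_eq] at hreg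

/-- The lower limit of a family of sets along a filter, formed in the lattice of regularly closed
sets: the closure of the union of all open sets eventually contained in the members. -/
def regularLiminf {I : Type*} (l : Filter I) (A : I → Set X) : Set X :=
  closure (⋃₀ {U | IsOpen U ∧ ∀ᶠ n in l, U ⊆ A n})

variable {I : Type*} {l : Filter I} {A B : I → Set X}

theorem isRegularlyClosed_regularLiminf (l : Filter I) (A : I → Set X) :
    IsRegularlyClosed (regularLiminf l A) :=
  .closure_of_isOpen (isOpen_sUnion fun _ hU => hU.1)

theorem regularLiminf_mono (h : ∀ n, A n ⊆ B n) : regularLiminf l A ⊆ regularLiminf l B :=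
  closure_mono (sUnion_subset_sUnion fun _ hU => ⟨hU.1, hU.2.mono fun n hn => hn.trans (h n)⟩)

theorem IsRegularlyClosed.subset_regularLiminf {C : Set X} (hC : IsRegularlyClosed C)
    (h : ∀ᶠ n in l, C ⊆ A n) : C ⊆ regularLiminf l A :=
  hC.ge.trans <| closure_mono <| subset_sUnion_of_mem
    ⟨isOpen_interior, h.mono fun _ hn => interior_subset.trans hn⟩

theorem regularLiminf_pure (n : I) (A : I → Set X) :
    regularLiminf (pure n) A = closure (interior (A n)) := by
  simp only [regularLiminf, eventually_pure, interior]

theorem eventually_not_subset_of_notMem_regularLiminf {l : Ultrafilter I} {p : X}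
    (hp : p ∉ regularLiminf (l : Filter I) A) {U : Set X} (hU : IsOpen U) (hpU : p ∈ U) :
    ∀ᶠ n in (l : Filter I), ¬ U ⊆ A n :=
  Ultrafilter.eventually_not.2 fun h => hp (subset_closure ⟨U, ⟨hU, h⟩, hpU⟩)

end RegularlyClosed

section Vietoris

variable {X : Type*} [TopologicalSpace X]

theorem exists_tendsto_of_forall_mem_nonemptyCompacts {I : Type*} {l : Ultrafilter I}
    {H : I → NonemptyCompacts X} {K : NonemptyCompacts X} (hH : Tendsto H l (𝓝 K)) {x : I → X}
    (hx : ∀ n, x n ∈ H n) : ∃ y ∈ K, Tendsto x l (𝓝 y) := by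
  have hle : map x l ≤ 𝓝ˢ (K : Set X) := by
    refine (hasBasis_nhdsSet _).ge_iff.2 fun U ⟨hU, hKU⟩ => ?_
    have hHU : ∀ᶠ n in (l : Filter I), (H n : Set X) ⊆ U :=
      hH.eventually ((NonemptyCompacts.isOpen_subsets_of_isOpen hU).mem_nhds hKU)
    exact hHU.mono fun n hn => hn (hx n)
  have hmeet : ¬ Disjoint (𝓝ˢ (K : Set X)) (map x l) := fun h =>
    NeBot.ne inferInstance (disjoint_self.1 (h.mono_left hle))
  rw [K.isCompact.disjoint_nhdsSet_left] at hmeet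
  push Not at hmeet
  obtain ⟨y, hyK, hy⟩ := hmeet
  exact ⟨y, hyK, (l.map x).le_of_inf_neBot' (neBot_iff.2 fun h => hy (disjoint_iff.2 h))⟩

/-- The box of all compacta that miss `D` and are not contained in any `C i`. In the paper's
notation, `[U₁, …, Uₖ]` is the box with `C i` the complement of `Uᵢ` and `D = ⋂ i, C i`. -/
def vietorisBox {ι : Type*} (D : Set X) (C : ι → Set X) : Set (NonemptyCompacts X) :=
  {G | Disjoint (G : Set X) D ∧ ∀ i, ¬ (G : Set X) ⊆ C i}

variable {ι κ : Type*}

theorem isOpen_vietorisBox [Finite ι] {D : Set X} {C : ι → Set X} (hD : IsClosed D)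
    (hC : ∀ i, IsClosed (C i)) : IsOpen (vietorisBox D C) := by
  simp only [vietorisBox, Set.ofPred_and, Set.ofPred_forall, ← subset_compl_iff_disjoint_right,
    ← inter_compl_nonempty_iff]
  exact (NonemptyCompacts.isOpen_subsets_of_isOpen hD.isOpen_compl).inter
    (isOpen_iInter_of_finite fun i =>
      NonemptyCompacts.isOpen_inter_nonempty_of_isOpen (hC i).isOpen_compl)

theorem vietorisBox_comp_surjective {f : κ → ι} (hf : f.Surjective) (D : Set X) (C : ι → Set X) :
    vietorisBox D (C ∘ f) = vietorisBox D C :=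
  Set.ext fun G => and_congr_right fun _ => hf.forall (p := fun i => ¬ (G : Set X) ⊆ C i).symm

theorem mem_vietorisBox_iInter_compl {U : ι → Set X} {G : NonemptyCompacts X} :
    G ∈ vietorisBox (⋂ j, (U j)ᶜ) (fun j => (U j)ᶜ) ↔
      (G : Set X) ⊆ ⋃ j, U j ∧ ∀ j, ((G : Set X) ∩ U j).Nonempty := by
  simp only [vietorisBox, Set.mem_ofPred_eq, ← compl_iUnion, disjoint_compl_right_iff_subset,
    subset_compl_iff_disjoint_right, not_disjoint_iff_nonempty_inter]

theorem exists_vietorisBox_subset_of_mem_nhds {G : NonemptyCompacts X}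
    {O : Set (NonemptyCompacts X)} (hO : O ∈ 𝓝 G) :
    ∃ (n : ℕ) (U : Fin n → Set X), (∀ j, IsOpen (U j)) ∧
      G ∈ vietorisBox (⋂ j, (U j)ᶜ) (fun j => (U j)ᶜ) ∧
      vietorisBox (⋂ j, (U j)ᶜ) (fun j => (U j)ᶜ) ⊆ O := by
  obtain ⟨_, ⟨u, ⟨hu, -, hopen⟩, rfl⟩, hG, huO⟩ :=
    NonemptyCompacts.isTopologicalBasis.mem_nhds_iff.1 hO
  obtain ⟨n, U, -, rfl⟩ := hu.fin_param
  simp only [sUnion_range, forall_mem_range] at hopen hG huO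
  exact ⟨n, U, hopen, mem_vietorisBox_iInter_compl.2 hG,
    fun F hF => huO (mem_vietorisBox_iInter_compl.1 hF)⟩

theorem vietorisBox_inter_nonempty [Finite ι] [Finite κ] [Nonempty κ] {U : κ → Set X} {D : Set X}
    {C : ι → Set X} (hDC : ∀ i, D ⊆ C i) (hD : ∀ j, ¬ U j ⊆ D) (hC : ∀ i, ∃ j, ¬ U j ⊆ C i) :
    (vietorisBox (⋂ j, (U j)ᶜ) (fun j => (U j)ᶜ) ∩ vietorisBox D C).Nonempty := by
  simp only [not_subset] at hD hC
  choose q hqU hqD using hD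
  choose j p hpU hpC using hC
  let y : κ ⊕ ι → X := Sum.elim q p
  let F : NonemptyCompacts X := ⟨⟨range y, (finite_range y).isCompact⟩, range_nonempty y⟩
  refine ⟨F, mem_vietorisBox_iInter_compl.2 ⟨?_, fun k => ⟨q k, ⟨.inl k, rfl⟩, hqU k⟩⟩, ?_,
    fun i hi => hpC i (hi ⟨.inr i, rfl⟩)⟩
  · rintro _ ⟨k | i, rfl⟩
    · exact mem_iUnion_of_mem k (hqU k)
    · exact mem_iUnion_of_mem (j i) (hpU i)
  · rw [Set.disjoint_left]
    rintro _ ⟨k | i, rfl⟩ hmem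
    · exact hqD k hmem
    · exact hpC i (hDC i hmem)

theorem nonempty_index_of_mem_vietorisBox {C : ι → Set X} {G : NonemptyCompacts X}
    (hG : G ∈ vietorisBox (⋂ i, C i) C) : Nonempty ι := by
  obtain ⟨x, hx⟩ := G.nonempty
  by_contra hι
  exact hG.1.notMem_of_mem_left hx (mem_iInter.2 fun i => (hι ⟨i⟩).elim)

end Vietoris

namespace IsQuasiKappaMetric

variable {X : Type u} [TopologicalSpace X] {ρ : X → Set X → ℝ≥0}

theorem eq_zero_of_mem (hρ : IsQuasiKappaMetric ρ) {C : Set X} (hC : IsRegularlyClosed C) {x : X}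
    (hx : x ∈ C) : ρ x C = 0 := by
  obtain ⟨V, -, hVC, -, hV⟩ := hρ.pos_iff C hC
  exact nonpos_iff_eq_zero.1 (not_lt.1 fun hpos => hVC ((hV x).1 hpos) hx)

theorem exists_pos_of_isOpen (hρ : IsQuasiKappaMetric ρ) {C : Set X} (hC : IsRegularlyClosed C)
    {U : Set X} (hU : IsOpen U) (hne : U.Nonempty) (hUC : Disjoint U C) : ∃ x ∈ U, 0 < ρ x C := by
  obtain ⟨V, -, -, hdense, hV⟩ := hρ.pos_iff C hC
  obtain ⟨p, hp⟩ := hne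
  obtain ⟨x, hxU, hxV⟩ := mem_closure_iff.1 (hdense (hUC.notMem_of_mem_left hp)) U hU hp
  exact ⟨x, hxU, (hV x).2 hxV⟩

/-- An infinite family is the increasing union, along a well-order of minimal length of its index
set, of the subfamilies of smaller cardinality indexed by the initial segments. -/
theorem le_closure_iUnion (hρ : IsQuasiKappaMetric ρ) {ι : Type u} {C : ι → Set X}
    (hC : ∀ i, IsRegularlyClosed (C i)) {ε : ℝ≥0} {x : X}
    (h : ∀ F : Finset ι, ε ≤ ρ x (⋃ i ∈ F, C i)) : ε ≤ ρ x (closure (⋃ i, C i)) := by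
  induction hκ : #ι using WellFoundedLT.induction generalizing ι with
  | ind κ ih =>
    subst hκ
    rcases finite_or_infinite ι with hι | hι
    · have := Fintype.ofFinite ι
      have hcl : IsClosed (⋃ i, C i) := isClosed_iUnion_of_finite fun i => (hC i).isClosed
      simpa [hcl.closure_eq] using h Finset.univ
    · obtain ⟨_, _, hord⟩ := exists_ord_eq_type_lt ι
      let E : ι → Set X := fun j => closure (⋃ i : Iic j, C i)
      have hE : Monotone E := fun j k hjk => closure_mono <| iUnion_subset fun i =>
        subset_iUnion (fun i : Iic k => C i) ⟨i, i.2.trans hjk⟩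
      have hCE : closure (⋃ i, C i) = closure (⋃ j, E j) := by
        refine (closure_mono (iUnion_mono fun j => ?_)).antisymm
          (closure_minimal (iUnion_subset fun j => closure_mono ?_) isClosed_closure)
        · exact (subset_iUnion (fun i : Iic j => C i) ⟨j, le_rfl⟩).trans subset_closure
        · exact iUnion_subset fun i => subset_iUnion C i
      rw [hCE, hρ.closure_iUnion ι E (fun j => .closure_iUnion fun i => hC i) hE x]
      refine le_ciInf fun j => ih _ (mk_Iic_lt j hord (aleph0_le_mk ι)) (fun i => hC i) ?_ rfl
      intro F
      simpa using h (F.map (Function.Embedding.subtype _))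

theorem le_regularLiminf (hρ : IsQuasiKappaMetric ρ) {I : Type*} {l : Filter I} {A : I → Set X}
    (hA : ∀ n, IsClosed (A n)) {ε : ℝ≥0} {x : X}
    (h : ∀ B, IsRegularlyClosed B → (∀ᶠ n in l, B ⊆ A n) → ε ≤ ρ x B) :
    ε ≤ ρ x (regularLiminf l A) := by
  let ι := {B : Set X // IsRegularlyClosed B ∧ ∀ᶠ n in l, B ⊆ A n}
  have hι : ∀ B : ι, IsRegularlyClosed B.1 := fun B => B.2.1
  have hle : ε ≤ ρ x (closure (⋃ B : ι, B.1)) := by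
    refine hρ.le_closure_iUnion hι fun F => h _ (.biUnion_finset hι F) ?_
    filter_upwards [(eventually_all_finset F).2 fun B _ => B.2.2] with n hn
    exact iUnion₂_subset hn
  refine hle.trans (hρ.anti _ _ (isRegularlyClosed_regularLiminf l A) (.closure_iUnion hι) ?_ x)
  refine closure_mono (sUnion_subset fun U ⟨hU, hUA⟩ => ?_)
  exact subset_closure.trans (subset_iUnion (fun B : ι => B.1) ⟨closure U, .closure_of_isOpen hU,
    hUA.mono fun n hn => closure_minimal hn (hA n)⟩)

section Limits

variable {I : Type*} {A : I → Set X} {ε : ℝ≥0}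

theorem le_regularLiminf_of_tendsto (hρ : IsQuasiKappaMetric ρ) {l : Filter I} [l.NeBot]
    (hA : ∀ n, IsRegularlyClosed (A n)) {x : I → X} {y : X} (hx : Tendsto x l (𝓝 y))
    (h : ∀ n, ε ≤ ρ (x n) (A n)) : ε ≤ ρ y (regularLiminf l A) := by
  refine hρ.le_regularLiminf (fun n => (hA n).isClosed) fun B hB hBA => ?_
  refine ge_of_tendsto (((hρ.cont B hB).tendsto y).comp hx) ?_
  filter_upwards [hBA] with n hn using (h n).trans (hρ.anti _ _ hB (hA n) hn _)

theorem forall_le_regularLiminf_of_tendsto (hρ : IsQuasiKappaMetric ρ) {l : Filter I} [l.NeBot]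
    (hA : ∀ n, IsRegularlyClosed (A n)) {H : I → NonemptyCompacts X} {K : NonemptyCompacts X}
    (hH : Tendsto H l (𝓝 K)) (h : ∀ n, ∀ x ∈ H n, ε ≤ ρ x (A n)) :
    ∀ x ∈ K, ε ≤ ρ x (regularLiminf l A) := by
  intro x hx
  refine hρ.le_regularLiminf (fun n => (hA n).isClosed) fun B hB hBA => ?_
  have hcl : IsClosed {y | ε ≤ ρ y B} := isClosed_le continuous_const (hρ.cont B hB)
  refine (NonemptyCompacts.isClosed_subsets_of_isClosed hcl).mem_of_tendsto hH ?_ hx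
  filter_upwards [hBA] with n hn y hy using (h n y hy).trans (hρ.anti _ _ hB (hA n) hn _)

theorem exists_le_regularLiminf_of_tendsto (hρ : IsQuasiKappaMetric ρ) {l : Ultrafilter I}
    (hA : ∀ n, IsRegularlyClosed (A n)) {H : I → NonemptyCompacts X} {K : NonemptyCompacts X}
    (hH : Tendsto H l (𝓝 K)) (h : ∀ n, ∃ x ∈ H n, ε ≤ ρ x (A n)) :
    ∃ x ∈ K, ε ≤ ρ x (regularLiminf (l : Filter I) A) := by
  choose x hx hle using h
  obtain ⟨y, hy, hxy⟩ := exists_tendsto_of_forall_mem_nonemptyCompacts hH hx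
  exact ⟨y, hy, hρ.le_regularLiminf_of_tendsto hA hxy hle⟩

end Limits

end IsQuasiKappaMetric

section AvoidingBox

variable {X : Type u} [TopologicalSpace X] {ι κ : Type*} {𝒞 : Set (NonemptyCompacts X)}

theorem eventually_inter_vietorisBox_nonempty [Finite ι] {I : Type*} {l : Ultrafilter I}
    {D : I → Set X} {C : I → ι → Set X} (hDC : ∀ n i, D n ⊆ C n i) {G : NonemptyCompacts X}
    (hG : G ∈ vietorisBox (regularLiminf l D) fun i => regularLiminf l fun n => C n i)
    {O : Set (NonemptyCompacts X)} (hO : O ∈ 𝓝 G) :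
    ∀ᶠ n in (l : Filter I), (O ∩ vietorisBox (D n) (C n)).Nonempty := by
  obtain ⟨m, U, hU, hGU, hUO⟩ := exists_vietorisBox_subset_of_mem_nhds hO
  have := nonempty_index_of_mem_vietorisBox hGU
  obtain ⟨hcover, hmeet⟩ := mem_vietorisBox_iInter_compl.1 hGU
  have hD : ∀ᶠ n in (l : Filter I), ∀ j, ¬ U j ⊆ D n := eventually_all.2 fun j => by
    obtain ⟨p, hpG, hpU⟩ := hmeet j
    exact eventually_not_subset_of_notMem_regularLiminf (hG.1.notMem_of_mem_left hpG) (hU j) hpU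
  have hC : ∀ᶠ n in (l : Filter I), ∀ i, ∃ j, ¬ U j ⊆ C n i := eventually_all.2 fun i => by
    obtain ⟨p, hpG, hpC⟩ := not_subset.1 (hG.2 i)
    obtain ⟨j, hpU⟩ := mem_iUnion.1 (hcover hpG)
    exact (eventually_not_subset_of_notMem_regularLiminf hpC (hU j) hpU).mono fun n hn => ⟨j, hn⟩
  filter_upwards [hD, hC] with n hnD hnC
  exact (vietorisBox_inter_nonempty (hDC n) hnD hnC).mono (inter_subset_inter_left _ hUO)

theorem disjoint_vietorisBox_regularLiminf [Finite ι] {I : Type*} {l : Ultrafilter I}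
    {D : I → Set X} {C : I → ι → Set X} {𝒞 : I → Set (NonemptyCompacts X)}
    (hDC : ∀ n i, D n ⊆ C n i) (h : ∀ n, Disjoint (vietorisBox (D n) (C n)) (𝒞 n)) :
    Disjoint (vietorisBox (regularLiminf l D) fun i => regularLiminf l fun n => C n i)
      (regularLiminf (l : Filter I) 𝒞) := by
  refine Disjoint.closure_right (Set.disjoint_left.2 ?_) <| isOpen_vietorisBox
    (isRegularlyClosed_regularLiminf _ _).isClosed
    fun _ => (isRegularlyClosed_regularLiminf _ _).isClosed
  rintro G hG ⟨O, ⟨hO, hO𝒞⟩, hGO⟩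
  obtain ⟨n, ⟨F, hFO, hF⟩, hn⟩ :=
    ((eventually_inter_vietorisBox_nonempty hDC hG (hO.mem_nhds hGO)).and hO𝒞).exists
  exact Set.disjoint_left.1 (h n) hF (hn hFO)

/-- `D ⊆ C i` are regularly closed sets whose box misses the set `𝒞` of compacta. -/
structure IsAvoidingBox (𝒞 : Set (NonemptyCompacts X)) (D : Set X) (C : ι → Set X) : Prop where
  base_regular : IsRegularlyClosed D
  regular : ∀ i, IsRegularlyClosed (C i)
  base_subset : ∀ i, D ⊆ C i
  disjoint : Disjoint (vietorisBox D C) 𝒞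

namespace IsAvoidingBox

theorem anti {𝒞' : Set (NonemptyCompacts X)} {D : Set X} {C : ι → Set X}
    (h : IsAvoidingBox 𝒞 D C) (h𝒞 : 𝒞' ⊆ 𝒞) : IsAvoidingBox 𝒞' D C :=
  { h with disjoint := h.disjoint.mono_right h𝒞 }

theorem comp_surjective {D : Set X} {C : ι → Set X} (h : IsAvoidingBox 𝒞 D C) {f : κ → ι}
    (hf : f.Surjective) : IsAvoidingBox 𝒞 D (C ∘ f) where
  base_regular := h.base_regular
  regular i := h.regular (f i)
  base_subset i := h.base_subset (f i)
  disjoint := vietorisBox_comp_surjective hf D C ▸ h.disjoint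

protected theorem regularLiminf [Finite ι] {I : Type*} {l : Ultrafilter I} {D : I → Set X}
    {C : I → ι → Set X} {𝒞 : I → Set (NonemptyCompacts X)}
    (h : ∀ n, IsAvoidingBox (𝒞 n) (D n) (C n)) :
    IsAvoidingBox (regularLiminf (l : Filter I) 𝒞) (regularLiminf (l : Filter I) D)
      fun i => regularLiminf (l : Filter I) fun n => C n i where
  base_regular := isRegularlyClosed_regularLiminf _ _
  regular _ := isRegularlyClosed_regularLiminf _ _
  base_subset i := regularLiminf_mono fun n => (h n).base_subset i
  disjoint := disjoint_vietorisBox_regularLiminf (fun n => (h n).base_subset) fun n =>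
    (h n).disjoint

theorem of_disjoint_vietorisBox [Finite ι] (h𝒞 : IsRegularlyClosed 𝒞) {D : Set X} {C : ι → Set X}
    (hDC : ∀ i, D ⊆ C i) (h : Disjoint (vietorisBox D C) 𝒞) :
    IsAvoidingBox 𝒞 (closure (interior D)) fun i => closure (interior (C i)) where
  base_regular := .closure_interior D
  regular i := .closure_interior (C i)
  base_subset i := closure_mono (interior_mono (hDC i))
  disjoint := by
    have hlim := disjoint_vietorisBox_regularLiminf (l := pure ()) (fun _ => hDC) fun _ => h
    simp only [Ultrafilter.coe_pure, regularLiminf_pure] at hlim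
    rwa [h𝒞] at hlim

end IsAvoidingBox

end AvoidingBox

section InnerBox

variable {X : Type u} [TopologicalSpace X] {ι κ : Type*} {ρ : X → Set X → ℝ≥0} {s t : ℝ≥0}
  {K : NonemptyCompacts X} {D : Set X} {C : ι → Set X}

/-- The compacta lying `s`-deep in the box of `D` and `C` with respect to `ρ`. They form a box as
well, given by sublevel sets of `ρ`. -/
def innerBox (ρ : X → Set X → ℝ≥0) (s : ℝ≥0) (D : Set X) (C : ι → Set X) :
    Set (NonemptyCompacts X) :=
  vietorisBox {x | ρ x D ≤ s} fun i => {x | ρ x (C i) ≤ s}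

theorem mem_innerBox :
    K ∈ innerBox ρ s D C ↔ (∀ x ∈ K, s < ρ x D) ∧ ∀ i, ∃ x ∈ K, s < ρ x (C i) := by
  simp only [innerBox, vietorisBox, Set.mem_ofPred_eq, Set.disjoint_left, not_subset, not_le,
    SetLike.mem_coe]

theorem innerBox_anti (ρ : X → Set X → ℝ≥0) (hst : s ≤ t) (D : Set X) (C : ι → Set X) :
    innerBox ρ t D C ⊆ innerBox ρ s D C := by
  intro K hK
  rw [mem_innerBox] at hK ⊢
  exact ⟨fun x hx => hst.trans_lt (hK.1 x hx),
    fun i => (hK.2 i).imp fun x hx => ⟨hx.1, hst.trans_lt hx.2⟩⟩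

theorem innerBox_comp_surjective {f : κ → ι} (hf : f.Surjective) (ρ : X → Set X → ℝ≥0) (s : ℝ≥0)
    (D : Set X) (C : ι → Set X) : innerBox ρ s D (C ∘ f) = innerBox ρ s D C :=
  vietorisBox_comp_surjective hf _ fun i => {x | ρ x (C i) ≤ s}

namespace IsQuasiKappaMetric

theorem isOpen_innerBox [Finite ι] (hρ : IsQuasiKappaMetric ρ) (hD : IsRegularlyClosed D)
    (hC : ∀ i, IsRegularlyClosed (C i)) (s : ℝ≥0) : IsOpen (innerBox ρ s D C) :=
  isOpen_vietorisBox (isClosed_le (hρ.cont D hD) continuous_const)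
    fun i => isClosed_le (hρ.cont _ (hC i)) continuous_const

theorem innerBox_subset_vietorisBox (hρ : IsQuasiKappaMetric ρ) (hD : IsRegularlyClosed D)
    (hC : ∀ i, IsRegularlyClosed (C i)) (s : ℝ≥0) : innerBox ρ s D C ⊆ vietorisBox D C :=
  fun _ hK => ⟨hK.1.mono_right fun _ hx => (hρ.eq_zero_of_mem hD hx).trans_le zero_le,
    fun i hi => hK.2 i fun _ hx => (hρ.eq_zero_of_mem (hC i) (hi hx)).trans_le zero_le⟩

theorem eventually_mem_innerBox [Finite ι] (hρ : IsQuasiKappaMetric ρ) (hD : IsRegularlyClosed D)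
    (hK : K ∈ innerBox ρ s D C) : ∀ᶠ t in 𝓝 s, K ∈ innerBox ρ t D C := by
  obtain ⟨hKD, hKC⟩ := mem_innerBox.1 hK
  obtain ⟨p, hp, hmin⟩ := K.isCompact.exists_isMinOn K.nonempty (hρ.cont D hD).continuousOn
  have hC : ∀ᶠ t in 𝓝 s, ∀ i, ∃ x ∈ K, t < ρ x (C i) := eventually_all.2 fun i => by
    obtain ⟨x, hx, hlt⟩ := hKC i
    exact (eventually_lt_nhds hlt).mono fun t ht => ⟨x, hx, ht⟩
  filter_upwards [eventually_lt_nhds (hKD p hp), hC] with t htD htC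
  exact mem_innerBox.2 ⟨fun x hx => htD.trans_le (hmin hx), htC⟩

theorem mem_innerBox_regularLiminf (hρ : IsQuasiKappaMetric ρ) {I : Type*} {l : Ultrafilter I}
    {H : I → NonemptyCompacts X} (hH : Tendsto H l (𝓝 K)) {D : I → Set X} {C : I → ι → Set X}
    (hD : ∀ n, IsRegularlyClosed (D n)) (hC : ∀ n i, IsRegularlyClosed (C n i)) (hst : s < t)
    (h : ∀ n, H n ∈ innerBox ρ t (D n) (C n)) :
    K ∈ innerBox ρ s (regularLiminf (l : Filter I) D)
      fun i => regularLiminf (l : Filter I) fun n => C n i := by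
  simp only [mem_innerBox] at h ⊢
  refine ⟨fun x hx => hst.trans_le ?_, fun i => ?_⟩
  · exact hρ.forall_le_regularLiminf_of_tendsto hD hH (fun n y hy => ((h n).1 y hy).le) x hx
  · obtain ⟨x, hx, hle⟩ := hρ.exists_le_regularLiminf_of_tendsto (fun n => hC n i) hH
      fun n => ((h n).2 i).imp fun y hy => ⟨hy.1, hy.2.le⟩
    exact ⟨x, hx, hst.trans_le hle⟩

end IsQuasiKappaMetric

theorem IsRegularQuasiKappaMetric.le_closure_interior_add (hρ : IsRegularQuasiKappaMetric ρ)
    {C : Set X} (hC : IsRegularlyClosed C) (x : X) (s : ℝ≥0) :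
    ρ x C ≤ ρ x (closure (interior {y | ρ y C ≤ s})) + s := by
  have hsup : ⨆ y ∈ closure (interior {y | ρ y C ≤ s}), (ρ y C : ℝ≥0∞) ≤ s :=
    iSup₂_le fun y hy => ENNReal.coe_le_coe.2 <|
      closure_minimal interior_subset (isClosed_le (hρ.cont C hC) continuous_const) hy
  rw [← ENNReal.coe_le_coe, ENNReal.coe_add]
  exact (hρ.le_add_sup C _ hC (.closure_interior _) x).trans (by gcongr)

theorem IsRegularQuasiKappaMetric.innerBox_add_subset (hρ : IsRegularQuasiKappaMetric ρ)
    (hD : IsRegularlyClosed D) (hC : ∀ i, IsRegularlyClosed (C i)) (r s : ℝ≥0) :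
    innerBox ρ (r + s) D C ⊆ innerBox ρ r (closure (interior {x | ρ x D ≤ s}))
      fun i => closure (interior {x | ρ x (C i) ≤ s}) := by
  intro K hK
  rw [mem_innerBox] at hK ⊢
  exact ⟨fun x hx =>
      lt_of_add_lt_add_right ((hK.1 x hx).trans_le (hρ.le_closure_interior_add hD x s)),
    fun i => (hK.2 i).imp fun x hx =>
      ⟨hx.1, lt_of_add_lt_add_right (hx.2.trans_le (hρ.le_closure_interior_add (hC i) x s))⟩⟩

end InnerBox

section HyperDist

variable {X : Type u} [TopologicalSpace X] {ρ : X → Set X → ℝ≥0} {K : NonemptyCompacts X}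
  {𝒞 : Set (NonemptyCompacts X)} {s : ℝ≥0}

/-- The (regular) quasi κ-metric on the hyperspace induced by `ρ`: the largest depth `s` at which
`K` lies in a box that misses `𝒞`, and `0` (the value of `sSup ∅`) if there is no such box. A box
given by `n` sets is only admitted below depth `1 / n`. -/
noncomputable def hyperDist (ρ : X → Set X → ℝ≥0) (K : NonemptyCompacts X)
    (𝒞 : Set (NonemptyCompacts X)) : ℝ≥0 :=
  sSup {s | ∃ (n : ℕ) (D : Set X) (C : Fin n → Set X), 0 < n ∧ n * s < 1 ∧
    IsAvoidingBox 𝒞 D C ∧ K ∈ innerBox ρ s D C}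

theorem exists_mem_innerBox_of_lt_hyperDist (h : s < hyperDist ρ K 𝒞) :
    ∃ (n : ℕ) (D : Set X) (C : Fin n → Set X), 0 < n ∧ n * s < 1 ∧
      IsAvoidingBox 𝒞 D C ∧ K ∈ innerBox ρ s D C := by
  obtain ⟨t, ⟨n, D, C, hn, hnt, hbox, hK⟩, hst⟩ := exists_lt_of_lt_csSup' h
  exact ⟨n, D, C, hn, (mul_le_mul_right hst.le _).trans_lt hnt, hbox,
    innerBox_anti ρ hst.le D C hK⟩

theorem exists_mem_innerBox_fin_floor_of_lt_hyperDist (hs : 0 < s) (h : s < hyperDist ρ K 𝒞) :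
    0 < ⌊s⁻¹⌋₊ ∧ ∃ (D : Set X) (C : Fin ⌊s⁻¹⌋₊ → Set X),
      IsAvoidingBox 𝒞 D C ∧ K ∈ innerBox ρ s D C := by
  obtain ⟨n, D, C, hn, hns, hbox, hK⟩ := exists_mem_innerBox_of_lt_hyperDist h
  have hle : n ≤ ⌊s⁻¹⌋₊ := Nat.le_floor (by simpa using (le_div_iff₀ hs).2 hns.le)
  have : Nonempty (Fin n) := ⟨⟨0, hn⟩⟩
  have hf := Function.invFun_surjective (Fin.castLE_injective hle)
  exact ⟨hn.trans_le hle, D, _, hbox.comp_surjective hf,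
    (innerBox_comp_surjective hf ρ s D C).ge hK⟩

namespace IsQuasiKappaMetric

theorem lt_hyperDist (hρ : IsQuasiKappaMetric ρ) {n : ℕ} (hn : 0 < n) (hns : n * s < 1)
    {D : Set X} {C : Fin n → Set X} (hbox : IsAvoidingBox 𝒞 D C) (hK : K ∈ innerBox ρ s D C) :
    s < hyperDist ρ K 𝒞 := by
  have hcont : Tendsto (fun t : ℝ≥0 => n * t) (𝓝 s) (𝓝 (n * s)) := tendsto_id.const_mul _
  obtain ⟨t, hst, hnt, hKt⟩ := ((hcont.eventually_lt_const hns).and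
    (hρ.eventually_mem_innerBox hbox.base_regular hK)).exists_gt
  refine hst.trans_le (le_csSup ⟨1, ?_⟩ ⟨n, D, C, hn, hnt, hbox, hKt⟩)
  rintro r ⟨m, _, _, hm, hmr, -⟩
  exact (le_mul_of_one_le_left' (Nat.one_le_cast.2 hm)).trans hmr.le

theorem hyperDist_anti (hρ : IsQuasiKappaMetric ρ) {𝒞' : Set (NonemptyCompacts X)} (h : 𝒞 ⊆ 𝒞')
    (K : NonemptyCompacts X) : hyperDist ρ K 𝒞' ≤ hyperDist ρ K 𝒞 := by
  refine le_of_forall_lt fun s hs => ?_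
  obtain ⟨n, D, C, hn, hns, hbox, hK⟩ := exists_mem_innerBox_of_lt_hyperDist hs
  exact hρ.lt_hyperDist hn hns (hbox.anti h) hK

theorem notMem_of_hyperDist_pos (hρ : IsQuasiKappaMetric ρ) (h : 0 < hyperDist ρ K 𝒞) :
    K ∉ 𝒞 := by
  obtain ⟨n, D, C, -, -, hbox, hK⟩ := exists_mem_innerBox_of_lt_hyperDist h
  exact hbox.disjoint.notMem_of_mem_left
    (hρ.innerBox_subset_vietorisBox hbox.base_regular hbox.regular 0 hK)

theorem compl_subset_closure_hyperDist_pos (hρ : IsQuasiKappaMetric ρ)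
    (h𝒞 : IsRegularlyClosed 𝒞) : 𝒞ᶜ ⊆ closure {K | 0 < hyperDist ρ K 𝒞} := by
  intro G hG
  refine mem_closure_iff_nhds.2 fun O hO => ?_
  obtain ⟨n, U, hU, hGU, hUO⟩ := exists_vietorisBox_subset_of_mem_nhds
    (inter_mem hO (h𝒞.isClosed.isOpen_compl.mem_nhds hG))
  have := nonempty_index_of_mem_vietorisBox hGU
  have hbox := IsAvoidingBox.of_disjoint_vietorisBox h𝒞 (iInter_subset fun j => (U j)ᶜ)
    (Set.disjoint_left.2 fun F hF => (hUO hF).2)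
  have hpos : ∀ j, ∃ x ∈ U j, 0 < ρ x (closure (interior (U j)ᶜ)) := fun j =>
    hρ.exists_pos_of_isOpen (hbox.regular j) (hU j)
      ((mem_vietorisBox_iInter_compl.1 hGU).2 j |>.mono inter_subset_right)
      (disjoint_compl_right.mono_right
        (closure_minimal interior_subset (hU j).isClosed_compl))
  have hanti : ∀ j x, ρ x (closure (interior (U j)ᶜ)) ≤ ρ x (closure (interior (⋂ j, (U j)ᶜ))) :=
    fun j => hρ.anti _ _ hbox.base_regular (hbox.regular j) (hbox.base_subset j)
  have hUC : ∀ j, ¬ U j ⊆ {x | ρ x (closure (interior (U j)ᶜ)) ≤ 0} := fun j =>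
    not_subset.2 ((hpos j).imp fun x hx => ⟨hx.1, hx.2.not_ge⟩)
  obtain ⟨F, hFU, hF⟩ := vietorisBox_inter_nonempty (fun j x hx => (hanti j x).trans hx)
    (fun j hj => hUC j fun x hx => (hanti j x).trans (hj hx)) fun j => ⟨j, hUC j⟩
  exact ⟨F, (hUO hFU).1, hρ.lt_hyperDist (Fin.pos_iff_nonempty.2 this) (by simp) hbox hF⟩

theorem le_hyperDist_regularLiminf (hρ : IsQuasiKappaMetric ρ) {I : Type*} {l : Ultrafilter I}
    {H : I → NonemptyCompacts X} (hH : Tendsto H l (𝓝 K)) {𝒞 : I → Set (NonemptyCompacts X)}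
    {ε : ℝ≥0} (h : ∀ n, ε ≤ hyperDist ρ (H n) (𝒞 n)) :
    ε ≤ hyperDist ρ K (regularLiminf (l : Filter I) 𝒞) := by
  refine le_of_forall_lt fun s hs => ?_
  obtain ⟨t, hst, htε⟩ := exists_between hs
  have htpos : 0 < t := zero_le.trans_lt hst
  choose hN D C hbox hHt using fun n =>
    exists_mem_innerBox_fin_floor_of_lt_hyperDist htpos (htε.trans_le (h n))
  obtain ⟨n⟩ := l.neBot.nonempty
  have hNs : (⌊t⁻¹⌋₊ : ℝ≥0) * s < 1 := calc
    (⌊t⁻¹⌋₊ : ℝ≥0) * s < ⌊t⁻¹⌋₊ * t := by gcongr; exact_mod_cast hN n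
    _ ≤ t⁻¹ * t := by gcongr; exact Nat.floor_le zero_le
    _ = 1 := inv_mul_cancel₀ htpos.ne'
  exact hρ.lt_hyperDist (hN n) hNs (.regularLiminf hbox) <|
    hρ.mem_innerBox_regularLiminf hH (fun n => (hbox n).base_regular)
      (fun n => (hbox n).regular) hst hHt

theorem isOpen_lt_hyperDist (hρ : IsQuasiKappaMetric ρ) (𝒞 : Set (NonemptyCompacts X)) (s : ℝ≥0) :
    IsOpen {K | s < hyperDist ρ K 𝒞} := by
  refine isOpen_iff_mem_nhds.2 fun K hK => ?_
  obtain ⟨n, D, C, hn, hns, hbox, hK⟩ := exists_mem_innerBox_of_lt_hyperDist hK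
  filter_upwards [(hρ.isOpen_innerBox hbox.base_regular hbox.regular s).mem_nhds hK] with L hL
  exact hρ.lt_hyperDist hn hns hbox hL

theorem isClosed_le_hyperDist (hρ : IsQuasiKappaMetric ρ) (h𝒞 : IsRegularlyClosed 𝒞) (s : ℝ≥0) :
    IsClosed {K | s ≤ hyperDist ρ K 𝒞} := by
  refine isClosed_of_closure_subset fun K hK => ?_
  have := mem_closure_iff_comap_neBot.1 hK
  obtain ⟨l, hl⟩ := Ultrafilter.exists_le (comap ((↑) : {K | s ≤ hyperDist ρ K 𝒞} → _) (𝓝 K))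
  exact (hρ.le_hyperDist_regularLiminf (tendsto_comap.mono_left hl) fun L => L.2).trans
    (hρ.hyperDist_anti (h𝒞.subset_regularLiminf (.of_forall fun _ => subset_rfl)) K)

theorem continuous_hyperDist (hρ : IsQuasiKappaMetric ρ) (h𝒞 : IsRegularlyClosed 𝒞) :
    Continuous fun K => hyperDist ρ K 𝒞 := by
  refine OrderTopology.continuous_iff.2 fun s => ⟨hρ.isOpen_lt_hyperDist 𝒞 s, ?_⟩
  have heq : (fun K => hyperDist ρ K 𝒞) ⁻¹' Iio s = {K | s ≤ hyperDist ρ K 𝒞}ᶜ := by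
    ext K
    simp
  exact heq ▸ (hρ.isClosed_le_hyperDist h𝒞 s).isOpen_compl

theorem hyperDist_closure_iUnion (hρ : IsQuasiKappaMetric ρ) {ι : Type*} [LinearOrder ι]
    [Nonempty ι] {𝒞 : ι → Set (NonemptyCompacts X)} (h𝒞 : ∀ i, IsRegularlyClosed (𝒞 i))
    (hmono : Monotone 𝒞) (K : NonemptyCompacts X) :
    hyperDist ρ K (closure (⋃ i, 𝒞 i)) = ⨅ i, hyperDist ρ K (𝒞 i) := by
  have hle : ∀ i, hyperDist ρ K (closure (⋃ i, 𝒞 i)) ≤ hyperDist ρ K (𝒞 i) := fun i =>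
    hρ.hyperDist_anti ((subset_iUnion 𝒞 i).trans subset_closure) K
  obtain ⟨l, hl⟩ := Ultrafilter.exists_le (atTop : Filter ι)
  have hlim : closure (⋃ i, 𝒞 i) ⊆ regularLiminf (l : Filter ι) 𝒞 := by
    refine closure_minimal (iUnion_subset fun i => (h𝒞 i).subset_regularLiminf (hl ?_))
      (isRegularlyClosed_regularLiminf _ _).isClosed
    filter_upwards [eventually_ge_atTop i] with j hij using hmono hij
  refine (le_ciInf hle).antisymm (le_trans ?_ (hρ.hyperDist_anti hlim K))
  exact hρ.le_hyperDist_regularLiminf tendsto_const_nhds fun i => ciInf_le (OrderBot.bddBelow _) i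

theorem isQuasiKappaMetric_hyperDist (hρ : IsQuasiKappaMetric ρ) :
    IsQuasiKappaMetric (hyperDist ρ) where
  pos_iff 𝒞 h𝒞 := ⟨{K | 0 < hyperDist ρ K 𝒞}, hρ.isOpen_lt_hyperDist 𝒞 0,
    fun _ => hρ.notMem_of_hyperDist_pos, hρ.compl_subset_closure_hyperDist_pos h𝒞,
    fun _ => Iff.rfl⟩
  anti _ _ _ _ h := hρ.hyperDist_anti h
  cont _ h𝒞 := hρ.continuous_hyperDist h𝒞
  closure_iUnion _ _ _ _ _ h𝒞 hmono := hρ.hyperDist_closure_iUnion h𝒞 hmono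

end IsQuasiKappaMetric

namespace IsRegularQuasiKappaMetric

theorem hyperDist_le_add (hρ : IsRegularQuasiKappaMetric ρ) {𝒞' : Set (NonemptyCompacts X)}
    (h𝒞' : IsRegularlyClosed 𝒞') (hs : ∀ G ∈ 𝒞', hyperDist ρ G 𝒞 ≤ s) (K : NonemptyCompacts X) :
    hyperDist ρ K 𝒞 ≤ hyperDist ρ K 𝒞' + s := by
  by_contra! hlt
  obtain ⟨n, D, C, hn, hns, hbox, hK⟩ := exists_mem_innerBox_of_lt_hyperDist hlt
  have hdisj : Disjoint (innerBox ρ s D C) 𝒞' := Set.disjoint_left.2 fun G hG hG𝒞' =>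
    (hρ.lt_hyperDist hn ((mul_le_mul_right le_add_self _).trans_lt hns) hbox hG).not_ge (hs G hG𝒞')
  have hbox' := IsAvoidingBox.of_disjoint_vietorisBox h𝒞' (fun i x hx =>
    (hρ.anti _ _ hbox.base_regular (hbox.regular i) (hbox.base_subset i) x).trans hx) hdisj
  exact (hρ.lt_hyperDist hn ((mul_le_mul_right le_self_add _).trans_lt hns) hbox'
    (hρ.innerBox_add_subset hbox.base_regular hbox.regular _ s hK)).false

theorem isRegularQuasiKappaMetric_hyperDist (hρ : IsRegularQuasiKappaMetric ρ) :
    IsRegularQuasiKappaMetric (hyperDist ρ) where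
  toIsQuasiKappaMetric := hρ.isQuasiKappaMetric_hyperDist
  le_add_sup 𝒞 𝒞' _ h𝒞' K := by
    have hle : ∀ G ∈ 𝒞', (hyperDist ρ G 𝒞 : ℝ≥0∞) ≤ ⨆ G ∈ 𝒞', (hyperDist ρ G 𝒞 : ℝ≥0∞) :=
      fun G hG => le_iSup₂ (f := fun G (_ : G ∈ 𝒞') => (hyperDist ρ G 𝒞 : ℝ≥0∞)) G hG
    generalize (⨆ G ∈ 𝒞', (hyperDist ρ G 𝒞 : ℝ≥0∞)) = s at hle ⊢
    cases s with
    | top => simp only [add_top, le_top]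
    | coe s => exact_mod_cast hρ.hyperDist_le_add h𝒞' (fun G hG => by exact_mod_cast hle G hG) K

end IsRegularQuasiKappaMetric

end HyperDist

theorem proposition3p10_general (X : Type u) [TopologicalSpace X] :
    (QuasiKappaMetrizable X → QuasiKappaMetrizable (NonemptyCompacts X)) ∧
    (RegularlyQuasiKappaMetrizable X → RegularlyQuasiKappaMetrizable (NonemptyCompacts X)) :=
  ⟨fun ⟨ρ, hρ⟩ => ⟨hyperDist ρ, hρ.isQuasiKappaMetric_hyperDist⟩,
    fun ⟨ρ, hρ⟩ => ⟨hyperDist ρ, hρ.isRegularQuasiKappaMetric_hyperDist⟩⟩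

/-- `NonemptyCompacts X` is the type of non-empty compact subsets of `X`; its topology in Mathlib
is the Vietoris topology. -/
theorem proposition3p10 (X : Type u) [TopologicalSpace X] [T35Space X] :
    (QuasiKappaMetrizable X → QuasiKappaMetrizable (NonemptyCompacts X)) ∧
    (RegularlyQuasiKappaMetrizable X → RegularlyQuasiKappaMetrizable (NonemptyCompacts X)) :=
  proposition3p10_general X
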